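/- For a positive integer $k$ put $\eta=\exp(2\pi\sqrt{-1}/k)$. The Sekine quantum group $\mathcal A_k$ is the complex Hopf algebra with underlying algebra $\left(\bigoplus_{i,j\in\mathbb Z_k}\mathbb C d_{ij}\right)\oplus \mathbb M_k(\mathbb C)$, where $\mathbb Z_k=\mathbb Z/k\mathbb Z$, the $d_{ij}$ are orthogonal idempotents and $e_{ij}$ ($i,j\in\mathbb Z_k$) are the matrix units of $\mathbb M_k(\mathbb C)$, and with structure maps $$\Delta(d_{ij})=\sum_{m,n\in\mathbb Z_k}d_{mn}\otimes d_{i-m,j-n}+\frac1k\sum_{m,n\in\mathbb Z_k}\eta^{i(m-n)}e_{mn}\otimes e_{m+j,n+j},$$ $$\Delta(e_{ij})=\sum_{m,n\in\mathbb Z_k}\eta^{m(i-j)}d_{-m,-n}\otimes e_{i-n,j-n}+\sum_{m,n\in\mathbb Z_k}\eta^{m(j-i)}e_{i-n,j-n}\otimes d_{mn},$$ $$\varepsilon(d_{ij})=\delta_{i0}\delta_{j0},\quad \varepsilon(e_{ij})=0,\quad S(d_{ij})=d_{-i,-j},\quad S(e_{ij})=e_{ji}.$$ Let $A$ be a semisimple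 complex Hopf algebra. A unital left coideal subalgebra is a unital subalgebra $L\subseteq A$ with $\Delta(L)\subseteq A\otimes L$. It is normal if $a\bullet x:=a_{(1)}xS(a_{(2)})\in L$ for all $a\in A$, $x\in L$. The integral of $L$ is the element $l\in L$ with $lx=xl=\varepsilon(x)l$ for all $x\in L$ and $\varepsilon(l)=1$. Write $Z(B)$ for the set of elements of $B$ commuting with all elements of $B$. The Hopf algebra $A$ is nilpotent if there is a chain $\mathbb C1=L_0\subseteq L_1\subseteq\dots\subseteq L_n=A$ of normal unital left coideal subalgebras, with integrals $l_j$ of $L_j$, such that $L_{j+1}l_j\subseteq Z(Al_j)$ for all $0\le j<n$ (we say that the chain witnesses nilpotency). It is solvable if there is a chain $\mathbb C1=L_0\subseteq L_1\subseteq\dots\subseteq L_n=A$ of unital left coideal subalgebras, with integrals $l_j$ of $L_j$, such that for all $0\le j<n$ one has $l_j\in Z(L_{j+1})$ and $(a\bullet b)l_j=\varepsilon(a)bl_j$ for all $a,b\in L_{j+1}$. **Theorem.** (1) For every integer $k\ge1$ the Sekine quantum group $\mathcal A_k$ is semisimple and nilpotent. More precisely, nilpotency is witnessed by the chain $\mathbb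 C1\subseteq L'_k\subseteq L'_1\subseteq\mathcal A_k$, where $$L'_k=\operatorname{span}\Big\{\sum_{r,s\in\mathbb Z_k}d_{r,s},\ \sum_{s\in\mathbb Z_k}e_{s,s}\Big\},$$ $$L'_1=\operatorname{span}\Big\{\sum_{r\in\mathbb Z_k}d_{p-r,q-r},\ \sum_{r\in\mathbb Z_k}\eta^{r(q-p)}e_{p-r,q-r}\ \Big|\ p,q\in\mathbb Z_k\Big\}.$$ (For $k=1$ the symbols $L'_k$ and $L'_1$ refer to these two displayed spaces, which then coincide.) (2) The Hopf algebra $\mathcal A_{15}$ is semisimple and solvable, it is neither commutative nor cocommutative, and its dimension is $2\cdot3^2\cdot5^2$, which is not of the form $p^aq^b$ with $p,q$ prime and $a,b\ge0$. So it is a non-trivial counterexample to the converse of Cohen and Westreich's analogue of Burnside's $p^aq^b$ theorem. -/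

import Mathlib

open scoped TensorProduct

noncomputable section
set_option linter.unusedSimpArgs false

section HopfNotions

variable {A : Type*} [Ring A] [HopfAlgebra ℂ A]

/-- The left adjoint action `a • b = a₍₁₎ b S(a₍₂₎)` of a Hopf algebra on itself. -/
def adAction (a b : A) : A :=
  LinearMap.mul' ℂ A
    (TensorProduct.map (LinearMap.mulRight ℂ b) (HopfAlgebra.antipode ℂ) (Coalgebra.comul a))

/-- A unital left coideal subalgebra of `A`: a linear subspace `L` that contains `1`, is closed
under multiplication and satisfies `Δ(L) ⊆ A ⊗ L`. -/
structure IsLeftCoidealSubalgebra (L : Submodule ℂ A) : Prop where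
  one_mem : (1 : A) ∈ L
  mul_mem : ∀ x ∈ L, ∀ y ∈ L, x * y ∈ L
  comul_mem : ∀ x ∈ L, Coalgebra.comul (R := ℂ) x ∈ LinearMap.range (L.subtype.lTensor A)

/-- `L` is stable under the left adjoint action of `A`. -/
def IsAdNormal (L : Submodule ℂ A) : Prop :=
  ∀ a : A, ∀ x ∈ L, adAction a x ∈ L

/-- `l` is the integral of `L`: an element of `L` with `l x = x l = ε(x) l` for all `x ∈ L`,
normalised by `ε(l) = 1`. The normalisation makes it unique; the conditions imposed on integrals
below do not change under multiplication of `l` by a nonzero scalar. -/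
structure IsNormalizedIntegral (L : Submodule ℂ A) (l : A) : Prop where
  mem : l ∈ L
  mul_left : ∀ x ∈ L, l * x = Coalgebra.counit (R := ℂ) x • l
  mul_right : ∀ x ∈ L, x * l = Coalgebra.counit (R := ℂ) x • l
  counit_eq_one : Coalgebra.counit (R := ℂ) l = 1

/-- The centre of a (possibly non-unital) multiplicatively closed set `s`: the elements of `s`
commuting with all of `s`. -/
def centerOf (s : Set A) : Set A :=
  {z | z ∈ s ∧ ∀ y ∈ s, z * y = y * z}

/-- A chain `L 0 ⊆ L 1 ⊆ ⋯ ⊆ L n` of normal left coideal subalgebras from `ℂ1` to `A` such that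
`L (j+1) l_j ⊆ Z(A l_j)`, where `l_j` is the integral of `L j`. -/
structure IsNilpotentSeries {n : ℕ} (L : Fin (n + 1) → Submodule ℂ A) : Prop where
  zero_eq : L 0 = Submodule.span ℂ {1}
  last_eq : L (Fin.last n) = ⊤
  coideal : ∀ j, IsLeftCoidealSubalgebra (L j)
  normal : ∀ j, IsAdNormal (L j)
  le_succ : ∀ j : Fin n, L j.castSucc ≤ L j.succ
  central : ∀ j : Fin n, ∃ l, IsNormalizedIntegral (L j.castSucc) l ∧
    ∀ x ∈ L j.succ, x * l ∈ centerOf (Set.range fun a : A => a * l)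

/-- A chain `L 0 ⊆ L 1 ⊆ ⋯ ⊆ L n` of left coideal subalgebras such that, `l_j` being the
integral of `L j`, `l_j` is central in `L (j+1)` and `(a • b) l_j = ε(a) b l_j` for all
`a, b ∈ L (j+1)`. -/
structure IsSolvableSeries {n : ℕ} (L : Fin (n + 1) → Submodule ℂ A) : Prop where
  coideal : ∀ j, IsLeftCoidealSubalgebra (L j)
  le_succ : ∀ j : Fin n, L j.castSucc ≤ L j.succ
  central : ∀ j : Fin n, ∃ l, IsNormalizedIntegral (L j.castSucc) l ∧
    l ∈ centerOf (L j.succ : Set A) ∧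
    ∀ a ∈ L j.succ, ∀ b ∈ L j.succ,
      adAction a b * l = Coalgebra.counit (R := ℂ) a • (b * l)

variable (A)

/-- Nilpotent (semisimple) Hopf algebras in the sense of Cohen and Westreich. -/
def IsNilpotentHopf : Prop :=
  IsSemisimpleRing A ∧ ∃ (n : ℕ) (L : Fin (n + 1) → Submodule ℂ A), IsNilpotentSeries L

/-- Solvable (semisimple) Hopf algebras in the sense of Cohen and Westreich. -/
def IsSolvableHopf : Prop :=
  IsSemisimpleRing A ∧ ∃ (n : ℕ) (L : Fin (n + 1) → Submodule ℂ A),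
    L 0 = Submodule.span ℂ {1} ∧ L (Fin.last n) = ⊤ ∧ IsSolvableSeries L

end HopfNotions

/-- The underlying algebra `(⨁_{i,j ∈ ℤ/k} ℂ d_{ij}) ⊕ M_k(ℂ)` of the Sekine quantum group. -/
def Sekine (k : ℕ) : Type := (ZMod k × ZMod k → ℂ) × Matrix (ZMod k) (ZMod k) ℂ

namespace Sekine

variable (k : ℕ) [NeZero k]

instance : Ring (Sekine k) :=
  inferInstanceAs (Ring ((ZMod k × ZMod k → ℂ) × Matrix (ZMod k) (ZMod k) ℂ))

instance : Algebra ℂ (Sekine k) :=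
  inferInstanceAs (Algebra ℂ ((ZMod k × ZMod k → ℂ) × Matrix (ZMod k) (ZMod k) ℂ))

/-- The minimal projection `d_{ij}` of the commutative summand. -/
def d (i j : ZMod k) : Sekine k := (Pi.single (i, j) 1, 0)

/-- The matrix unit `e_{ij}` of the matrix summand. -/
def e (i j : ZMod k) : Sekine k := (0, Matrix.single i j 1)

/-- The power `η ^ a` of the root of unity `η = exp(2πi/k)`. -/
def etaPow (a : ZMod k) : ℂ := ZMod.stdAddChar a

/-- `Δ(d_{ij})`. -/
def comulD (i j : ZMod k) : Sekine k ⊗[ℂ] Sekine k :=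
  (∑ m, ∑ n, d k m n ⊗ₜ[ℂ] d k (i - m) (j - n)) +
    (1 / (k : ℂ)) • ∑ m, ∑ n, etaPow k (i * (m - n)) • (e k m n ⊗ₜ[ℂ] e k (m + j) (n + j))

/-- `Δ(e_{ij})`. -/
def comulE (i j : ZMod k) : Sekine k ⊗[ℂ] Sekine k :=
  (∑ m, ∑ n, etaPow k (m * (i - j)) • (d k (-m) (-n) ⊗ₜ[ℂ] e k (i - n) (j - n))) +
    ∑ m, ∑ n, etaPow k (m * (j - i)) • (e k (i - n) (j - n) ⊗ₜ[ℂ] d k m n)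

/-- The linear map on `A_k` with prescribed values on the basis `d_{ij}`, `e_{ij}`. -/
def linearExt {M : Type*} [AddCommGroup M] [Module ℂ M] (f g : ZMod k → ZMod k → M) :
    Sekine k →ₗ[ℂ] M where
  toFun x := (∑ i, ∑ j, x.1 (i, j) • f i j) + ∑ i, ∑ j, x.2 i j • g i j
  map_add' x y := by
    have h1 : ∀ p, (x + y).1 p = x.1 p + y.1 p := fun _ => rfl
    have h2 : ∀ i j, (x + y).2 i j = x.2 i j + y.2 i j := fun _ _ => rfl
    simp only [h1, h2, add_smul, Finset.sum_add_distrib]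
    abel
  map_smul' c x := by
    have h1 : ∀ p, (c • x).1 p = c * x.1 p := fun _ => rfl
    have h2 : ∀ i j, (c • x).2 i j = c * x.2 i j := fun _ _ => rfl
    simp only [h1, h2, mul_smul, smul_add, Finset.smul_sum, RingHom.id_apply]

section Helpers

variable {k}

lemma linearExt_d {M : Type*} [AddCommGroup M] [Module ℂ M] (f g : ZMod k → ZMod k → M)
    (i j : ZMod k) : linearExt k f g (d k i j) = f i j := by
  simp only [linearExt, d, LinearMap.coe_mk, AddHom.coe_mk, Pi.single_apply, Prod.mk.injEq,
    ite_smul, one_smul, zero_smul, Matrix.zero_apply, Finset.sum_const_zero, add_zero]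
  rw [Finset.sum_eq_single i, Finset.sum_eq_single j] <;> simp +contextual

lemma linearExt_e {M : Type*} [AddCommGroup M] [Module ℂ M] (f g : ZMod k → ZMod k → M)
    (i j : ZMod k) : linearExt k f g (e k i j) = g i j := by
  simp only [linearExt, e, LinearMap.coe_mk, AddHom.coe_mk, Matrix.single_apply,
    ite_smul, one_smul, zero_smul, Pi.zero_apply, Finset.sum_const_zero, zero_add]
  rw [Finset.sum_eq_single i, Finset.sum_eq_single j] <;> simp +contextual [eq_comm]

lemma eq_sum (x : Sekine k) :
    x = (∑ i, ∑ j, x.1 (i, j) • d k i j) + ∑ i, ∑ j, x.2 i j • e k i j := by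
  have key : ∀ y : (ZMod k × ZMod k → ℂ) × Matrix (ZMod k) (ZMod k) ℂ,
      y = (∑ i, ∑ j, y.1 (i, j) •
        ((Pi.single (i, j) 1, 0) : (ZMod k × ZMod k → ℂ) × Matrix (ZMod k) (ZMod k) ℂ)) +
        ∑ i, ∑ j, y.2 i j •
        ((0, Matrix.single i j 1) : (ZMod k × ZMod k → ℂ) × Matrix (ZMod k) (ZMod k) ℂ) := by
    intro y
    refine Prod.ext ?_ ?_
    · funext p
      obtain ⟨a, b⟩ := p
      simp only [Prod.fst_add, Prod.fst_sum, Prod.smul_fst, Pi.add_apply, Finset.sum_apply,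
        Pi.smul_apply, smul_zero, Pi.zero_apply, Finset.sum_const_zero, add_zero,
        Pi.single_apply, Prod.mk.injEq]
      rw [Finset.sum_eq_single a, Finset.sum_eq_single b] <;> simp +contextual [eq_comm]
    · ext a b
      simp only [Prod.snd_add, Prod.snd_sum, Prod.smul_snd, Matrix.add_apply, Matrix.sum_apply,
        Matrix.smul_apply, smul_zero, Matrix.zero_apply, Finset.sum_const_zero, zero_add,
        Matrix.single_apply]
      rw [Finset.sum_eq_single a, Finset.sum_eq_single b] <;> simp +contextual
  exact key x

lemma hom_ext {M : Type*} [AddCommGroup M] [Module ℂ M] {f g : Sekine k →ₗ[ℂ] M}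
    (hd : ∀ i j, f (d k i j) = g (d k i j)) (he : ∀ i j, f (e k i j) = g (e k i j)) : f = g := by
  ext x
  rw [eq_sum x]
  simp only [map_add, map_sum, map_smul, hd, he]

lemma d_mul_d (i j i' j' : ZMod k) :
    d k i j * d k i' j' = if i = i' then (if j = j' then d k i j else 0) else 0 := by
  have : d k i j * d k i' j' =
      ((Pi.single (i, j) 1 * Pi.single (i', j') 1 : ZMod k × ZMod k → ℂ),
        (0 * 0 : Matrix (ZMod k) (ZMod k) ℂ)) := rfl
  rw [this, mul_zero]
  split_ifs with h1 h2
  · subst h1 h2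
    rw [← Pi.single_mul, mul_one]; rfl
  · refine Prod.ext ?_ rfl
    funext p
    simp only [Pi.mul_apply, Pi.single_apply]
    change _ = (0 : ℂ)
    aesop
  · refine Prod.ext ?_ rfl
    funext p
    simp only [Pi.mul_apply, Pi.single_apply]
    change _ = (0 : ℂ)
    aesop

lemma e_mul_e (i j i' j' : ZMod k) :
    e k i j * e k i' j' = if j = i' then e k i j' else 0 := by
  have : e k i j * e k i' j' =
      ((0 * 0 : ZMod k × ZMod k → ℂ),
        (Matrix.single i j 1 * Matrix.single i' j' 1 : Matrix (ZMod k) (ZMod k) ℂ)) := rfl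
  rw [this, mul_zero]
  split_ifs with h1
  · subst h1
    rw [Matrix.single_mul_single_same, mul_one]; rfl
  · rw [Matrix.single_mul_single_of_ne _ _ _ _ h1]; rfl

lemma d_mul_e (i j i' j' : ZMod k) : d k i j * e k i' j' = 0 := by
  refine Prod.ext (mul_zero _) (zero_mul _)

lemma e_mul_d (i j i' j' : ZMod k) : e k i j * d k i' j' = 0 := by
  refine Prod.ext (zero_mul _) (mul_zero _)

lemma one_eq : (1 : Sekine k) = (∑ i, ∑ j, d k i j) + ∑ i, e k i i := by
  have h1 : ∀ p, (1 : Sekine k).1 p = 1 := fun _ => rfl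
  have h2 : ∀ i j, (1 : Sekine k).2 i j = (1 : Matrix (ZMod k) (ZMod k) ℂ) i j := fun _ _ => rfl
  conv_lhs => rw [eq_sum (1 : Sekine k)]
  simp only [h1, h2, one_smul, Matrix.one_apply, ite_smul, zero_smul, Finset.sum_ite_eq,
    Finset.mem_univ, if_true]

lemma etaPow_zero : etaPow k 0 = 1 := by simp [etaPow]

lemma etaPow_mul (a b : ZMod k) : etaPow k a * etaPow k b = etaPow k (a + b) := by
  simp [etaPow, AddChar.map_add_eq_mul]

lemma sum_etaPow (a : ZMod k) : ∑ n, etaPow k (n * a) = if a = 0 then (k : ℂ) else 0 := by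
  have := AddChar.sum_mulShift a (ZMod.isPrimitive_stdAddChar k)
  simpa [etaPow, ZMod.card] using this

lemma k_ne_zero : (k : ℂ) ≠ 0 := by exact_mod_cast NeZero.ne k

end Helpers

section Structure

/-- The comultiplication of `A_k` as a linear map. -/
def comulLin : Sekine k →ₗ[ℂ] Sekine k ⊗[ℂ] Sekine k := linearExt k (comulD k) (comulE k)

/-- The counit of `A_k`: `ε(d_{ij}) = δ_{i0} δ_{j0}`, `ε(e_{ij}) = 0`. -/
def counitLin : Sekine k →ₗ[ℂ] ℂ :=
  linearExt k (fun i j => if i = 0 then (if j = 0 then 1 else 0) else 0) (fun _ _ => 0)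

/-- The antipode of `A_k`: `S(d_{ij}) = d_{-i,-j}`, `S(e_{ij}) = e_{ji}`. -/
def antipodeLin : Sekine k →ₗ[ℂ] Sekine k :=
  linearExt k (fun i j => d k (-i) (-j)) (fun i j => e k j i)

variable {k}

lemma comulLin_d (i j : ZMod k) : comulLin k (d k i j) = comulD k i j := linearExt_d _ _ i j
lemma comulLin_e (i j : ZMod k) : comulLin k (e k i j) = comulE k i j := linearExt_e _ _ i j
lemma counitLin_d (i j : ZMod k) :
    counitLin k (d k i j) = if i = 0 then (if j = 0 then 1 else 0) else 0 := linearExt_d _ _ i j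
lemma counitLin_e (i j : ZMod k) : counitLin k (e k i j) = 0 := linearExt_e _ _ i j
lemma antipodeLin_d (i j : ZMod k) : antipodeLin k (d k i j) = d k (-i) (-j) :=
  linearExt_d _ _ i j
lemma antipodeLin_e (i j : ZMod k) : antipodeLin k (e k i j) = e k j i := linearExt_e _ _ i j

lemma sum_shift {M : Type*} [AddCommMonoid M] (c : ZMod k) (f : ZMod k → M) :
    ∑ x, f (x + c) = ∑ x, f x := Fintype.sum_equiv (Equiv.addRight c) _ _ (fun _ => rfl)

lemma sum_neg' {M : Type*} [AddCommMonoid M] (f : ZMod k → M) :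
    ∑ x, f (-x) = ∑ x, f x := Fintype.sum_equiv (Equiv.neg _) _ _ (fun _ => rfl)

lemma sum2_reindex {M : Type*} [AddCommMonoid M] (f g : ZMod k → ZMod k → M)
    (σ : (ZMod k × ZMod k) ≃ (ZMod k × ZMod k))
    (h : ∀ p, f p.1 p.2 = g (σ p).1 (σ p).2) : ∑ a, ∑ b, f a b = ∑ a, ∑ b, g a b := by
  rw [← Fintype.sum_prod_type', ← Fintype.sum_prod_type']
  exact Fintype.sum_equiv σ _ _ h

lemma sum4_reindex {M : Type*} [AddCommMonoid M]
    (f g : ZMod k → ZMod k → ZMod k → ZMod k → M)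
    (σ : (ZMod k × ZMod k × ZMod k × ZMod k) ≃ (ZMod k × ZMod k × ZMod k × ZMod k))
    (h : ∀ p, f p.1 p.2.1 p.2.2.1 p.2.2.2 =
      g (σ p).1 (σ p).2.1 (σ p).2.2.1 (σ p).2.2.2) :
    ∑ a, ∑ b, ∑ c, ∑ e, f a b c e = ∑ a, ∑ b, ∑ c, ∑ e, g a b c e := by
  have key : ∀ f : ZMod k → ZMod k → ZMod k → ZMod k → M, ∑ a, ∑ b, ∑ c, ∑ e, f a b c e =
      ∑ p : ZMod k × ZMod k × ZMod k × ZMod k, f p.1 p.2.1 p.2.2.1 p.2.2.2 := by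
    intro f
    simp only [Fintype.sum_prod_type]
  rw [key, key]
  exact Fintype.sum_equiv σ _ _ h

lemma sum2_mul_sum2 {R : Type*} [NonUnitalNonAssocSemiring R] (f g : ZMod k → ZMod k → R) :
    (∑ a, ∑ b, f a b) * (∑ a, ∑ b, g a b) = ∑ a, ∑ b, ∑ c, ∑ e, f a b * g c e := by
  simp only [Finset.sum_mul]
  refine Finset.sum_congr rfl fun a _ => Finset.sum_congr rfl fun b _ => ?_
  simp only [Finset.mul_sum]

lemma sum_etaPow_conv (i i' m n : ZMod k) :
    ∑ x, etaPow k (i * (m - x)) * etaPow k (i' * (x - n)) =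
      if i = i' then (k : ℂ) * etaPow k (i * (m - n)) else 0 := by
  have h : ∀ x, etaPow k (i * (m - x)) * etaPow k (i' * (x - n)) =
      etaPow k (i * m - i' * n) * etaPow k (x * (i' - i)) := fun x => by
    rw [etaPow_mul, etaPow_mul]; congr 1; ring
  simp only [h, ← Finset.mul_sum, sum_etaPow, sub_eq_zero]
  by_cases hi : i = i'
  · subst hi
    simp [mul_sub, mul_comm]
  · simp [hi, Ne.symm hi, eq_comm]

lemma sum3_reindex {M : Type*} [AddCommMonoid M]
    (f g : ZMod k → ZMod k → ZMod k → M)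
    (σ : (ZMod k × ZMod k × ZMod k) ≃ (ZMod k × ZMod k × ZMod k))
    (h : ∀ p, f p.1 p.2.1 p.2.2 = g (σ p).1 (σ p).2.1 (σ p).2.2) :
    ∑ a, ∑ b, ∑ c, f a b c = ∑ a, ∑ b, ∑ c, g a b c := by
  have key : ∀ f : ZMod k → ZMod k → ZMod k → M, ∑ a, ∑ b, ∑ c, f a b c =
      ∑ p : ZMod k × ZMod k × ZMod k, f p.1 p.2.1 p.2.2 := by
    intro f
    simp only [Fintype.sum_prod_type]
  rw [key, key]
  exact Fintype.sum_equiv σ _ _ h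

lemma sum4_collapse {M : Type*} [AddCommGroup M] [Module ℂ M] (s₀ : ZMod k)
    (c : ZMod k → ZMod k → ZMod k → ℂ) (s : ZMod k → ZMod k → ZMod k)
    (hc : ∀ x y z, c x y z = (1 / (k : ℂ)) * etaPow k (x * s y z))
    (hs : ∀ y z, s y z = 0 ↔ y - s₀ = z)
    (T : ZMod k → ZMod k → ZMod k → M) :
    ∑ x, ∑ a, ∑ y, ∑ z, c x y z • T a y z = ∑ a, ∑ y, T a y (y - s₀) := by
  rw [Finset.sum_comm]
  refine Finset.sum_congr rfl fun a _ => ?_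
  rw [Finset.sum_comm]
  refine Finset.sum_congr rfl fun y _ => ?_
  rw [Finset.sum_comm]
  simp only [hc, ← Finset.sum_smul, ← Finset.mul_sum, sum_etaPow, hs, mul_ite, mul_zero, ite_smul,
    zero_smul, Finset.sum_ite_eq, Finset.mem_univ, if_true]
  rw [one_div, inv_mul_cancel₀ k_ne_zero, one_smul]

lemma comulD_mul_comulD (i j i' j' : ZMod k) :
    comulD k i j * comulD k i' j' =
      if i = i' then (if j = j' then comulD k i j else 0) else 0 := by
  have h1 : (∑ m, ∑ n, d k m n ⊗ₜ[ℂ] d k (i - m) (j - n)) *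
      (∑ m, ∑ n, d k m n ⊗ₜ[ℂ] d k (i' - m) (j' - n)) =
      if i = i' then (if j = j' then ∑ m, ∑ n, d k m n ⊗ₜ[ℂ] d k (i - m) (j - n) else 0)
        else 0 := by
    rw [sum2_mul_sum2]
    simp only [Algebra.TensorProduct.tmul_mul_tmul, d_mul_d,
      TensorProduct.ite_tmul, TensorProduct.zero_tmul]
    simp only [Finset.sum_ite_irrel, Finset.sum_ite_eq, Finset.sum_const_zero, Finset.mem_univ,
      if_true, sub_left_inj, TensorProduct.tmul_ite, TensorProduct.tmul_zero]
  have h2 : (∑ m, ∑ n, etaPow k (i * (m - n)) • (e k m n ⊗ₜ[ℂ] e k (m + j) (n + j))) *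
      (∑ m, ∑ n, etaPow k (i' * (m - n)) • (e k m n ⊗ₜ[ℂ] e k (m + j') (n + j'))) =
      if i = i' then (if j = j' then (k : ℂ) •
        ∑ m, ∑ n, etaPow k (i * (m - n)) • (e k m n ⊗ₜ[ℂ] e k (m + j) (n + j)) else 0)
        else 0 := by
    rw [sum2_mul_sum2]
    simp only [Algebra.TensorProduct.tmul_mul_tmul, e_mul_e, smul_mul_assoc, mul_smul_comm,
      TensorProduct.ite_tmul, TensorProduct.zero_tmul, smul_ite, smul_zero]
    simp only [Finset.sum_ite_irrel, Finset.sum_ite_eq, Finset.sum_const_zero, Finset.mem_univ,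
      if_true, add_right_inj, TensorProduct.tmul_ite, TensorProduct.tmul_zero, smul_ite, smul_zero]
    split_ifs with hj hi hi
    · rw [Finset.smul_sum]
      refine Finset.sum_congr rfl fun m _ => ?_
      rw [Finset.sum_comm, Finset.smul_sum]
      refine Finset.sum_congr rfl fun n _ => ?_
      simp only [smul_smul, ← Finset.sum_smul]
      rw [Finset.sum_congr rfl fun x _ => mul_comm (etaPow k (i' * (x - n))) _,
        sum_etaPow_conv, if_pos hi, hj]
    · refine Finset.sum_eq_zero fun m _ => ?_
      rw [Finset.sum_comm]
      refine Finset.sum_eq_zero fun n _ => ?_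
      simp only [smul_smul, ← Finset.sum_smul]
      rw [Finset.sum_congr rfl fun x _ => mul_comm (etaPow k (i' * (x - n))) _,
        sum_etaPow_conv, if_neg hi, zero_smul]
    · rfl
    · rfl
  have h4 : (∑ m, ∑ n, d k m n ⊗ₜ[ℂ] d k (i - m) (j - n)) *
      (∑ m, ∑ n, etaPow k (i' * (m - n)) • (e k m n ⊗ₜ[ℂ] e k (m + j') (n + j'))) = 0 := by
    rw [sum2_mul_sum2]
    simp only [mul_smul_comm, Algebra.TensorProduct.tmul_mul_tmul, d_mul_e,
      TensorProduct.zero_tmul, smul_zero, Finset.sum_const_zero]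
  have h5 : (∑ m, ∑ n, etaPow k (i * (m - n)) • (e k m n ⊗ₜ[ℂ] e k (m + j) (n + j))) *
      (∑ m, ∑ n, d k m n ⊗ₜ[ℂ] d k (i' - m) (j' - n)) = 0 := by
    rw [sum2_mul_sum2]
    simp only [smul_mul_assoc, Algebra.TensorProduct.tmul_mul_tmul, e_mul_d,
      TensorProduct.zero_tmul, smul_zero, Finset.sum_const_zero]
  simp only [comulD, add_mul, mul_add, smul_mul_assoc, mul_smul_comm, h1, h2, h4, h5, smul_zero,
    add_zero, zero_add]
  split_ifs with hi hj
  · rw [smul_smul, smul_smul]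
    congr 2
    field_simp
  · simp
  · simp

lemma comulD_mul_comulE (i j i' j' : ZMod k) : comulD k i j * comulE k i' j' = 0 := by
  simp only [comulD, comulE, Finset.sum_mul, Finset.mul_sum, add_mul, mul_add, smul_mul_assoc,
    mul_smul_comm, Algebra.TensorProduct.tmul_mul_tmul, d_mul_e, e_mul_d,
    TensorProduct.zero_tmul, TensorProduct.tmul_zero, smul_zero, Finset.sum_const_zero, add_zero]

lemma comulE_mul_comulD (i j i' j' : ZMod k) : comulE k i j * comulD k i' j' = 0 := by
  simp only [comulD, comulE, Finset.sum_mul, Finset.mul_sum, add_mul, mul_add, smul_mul_assoc,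
    mul_smul_comm, Algebra.TensorProduct.tmul_mul_tmul, d_mul_e, e_mul_d,
    TensorProduct.zero_tmul, TensorProduct.tmul_zero, smul_zero, Finset.sum_const_zero, add_zero]

lemma comulE_mul_comulE (i j i' j' : ZMod k) :
    comulE k i j * comulE k i' j' = if j = i' then comulE k i j' else 0 := by
  simp only [comulE, add_mul, mul_add, sum2_mul_sum2]
  simp only [smul_mul_assoc,
    mul_smul_comm, Algebra.TensorProduct.tmul_mul_tmul, d_mul_e, e_mul_d, d_mul_d, e_mul_e,
    TensorProduct.zero_tmul, TensorProduct.tmul_zero, smul_zero, Finset.sum_const_zero, add_zero,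
    zero_add, neg_inj, TensorProduct.ite_tmul, TensorProduct.tmul_ite, smul_ite]
  have rot : ∀ (p q r : Prop) [Decidable p] [Decidable q] [Decidable r]
      (x : Sekine k ⊗[ℂ] Sekine k), (if p then if q then if r then x else 0 else 0 else 0) =
        if q then if r then if p then x else 0 else 0 else 0 := by
    intro p q r _ _ _ x
    split_ifs <;> rfl
  simp only [rot, Finset.sum_ite_irrel, Finset.sum_ite_eq, Finset.sum_const_zero, Finset.mem_univ,
      if_true, sub_left_inj]
  split_ifs with h
  · subst h
    simp only [smul_smul, etaPow_mul]
    congr 1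
    · refine Finset.sum_congr rfl fun m _ => Finset.sum_congr rfl fun n _ => ?_
      congr 2; ring
    · refine Finset.sum_congr rfl fun m _ => Finset.sum_congr rfl fun n _ => ?_
      congr 2; ring
  · simp

lemma comul_one' : comulLin k 1 = 1 := by
  have h1 : ∑ i, ∑ j, ∑ m, ∑ n, d k m n ⊗ₜ[ℂ] d k (i - m) (j - n) =
      ∑ i, ∑ j, ∑ m, ∑ n, d k m n ⊗ₜ[ℂ] d k i j := by
    refine sum4_reindex _ _
      { toFun := fun p => (p.1 - p.2.2.1, p.2.1 - p.2.2.2, p.2.2.1, p.2.2.2)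
        invFun := fun p => (p.1 + p.2.2.1, p.2.1 + p.2.2.2, p.2.2.1, p.2.2.2)
        left_inv := fun p => by simp
        right_inv := fun p => by simp } fun p => rfl
  have h2 : ∑ i, ∑ j, (1 / (k : ℂ)) •
      ∑ m, ∑ n, etaPow k (i * (m - n)) • (e k m n ⊗ₜ[ℂ] e k (m + j) (n + j)) =
      ∑ n, ∑ m, e k m m ⊗ₜ[ℂ] e k n n := by
    rw [Finset.sum_comm]
    have : ∀ j, ∑ i, (1 / (k : ℂ)) •
        ∑ m, ∑ n, etaPow k (i * (m - n)) • (e k m n ⊗ₜ[ℂ] e k (m + j) (n + j)) =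
        ∑ m, e k m m ⊗ₜ[ℂ] e k (m + j) (m + j) := fun j => by
      rw [← Finset.smul_sum, Finset.sum_comm, Finset.smul_sum]
      refine Finset.sum_congr rfl fun m _ => ?_
      rw [Finset.sum_comm]
      simp only [← Finset.sum_smul, sum_etaPow, sub_eq_zero, ite_smul, zero_smul,
        Finset.sum_ite_eq, Finset.mem_univ, if_true, smul_smul]
      rw [one_div, inv_mul_cancel₀ k_ne_zero, one_smul]
    simp only [this]
    rw [Finset.sum_comm, Finset.sum_comm (s := Finset.univ) (t := Finset.univ)
      (f := fun n m => e k m m ⊗ₜ[ℂ] e k n n)]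
    refine Finset.sum_congr rfl fun m _ => ?_
    simp only [add_comm m]
    exact sum_shift m fun n => e k m m ⊗ₜ[ℂ] e k n n
  have h3 : ∑ i, ∑ m, ∑ n, d k (-m) (-n) ⊗ₜ[ℂ] e k (i - n) (i - n) =
      ∑ i, ∑ m, ∑ n, d k m n ⊗ₜ[ℂ] e k i i :=
    sum3_reindex _ _
      { toFun := fun p => (p.1 - p.2.2, -p.2.1, -p.2.2)
        invFun := fun p => (p.1 - p.2.2, -p.2.1, -p.2.2)
        left_inv := fun p => by simp
        right_inv := fun p => by simp } fun p => rfl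
  have h4 : ∑ i, ∑ m, ∑ n, e k (i - n) (i - n) ⊗ₜ[ℂ] d k m n =
      ∑ m, ∑ n, ∑ i, e k i i ⊗ₜ[ℂ] d k m n :=
    sum3_reindex _ _
      { toFun := fun p => (p.2.1, p.2.2, p.1 - p.2.2)
        invFun := fun p => (p.2.2 + p.2.1, p.1, p.2.1)
        left_inv := fun p => by simp
        right_inv := fun p => by simp } fun p => rfl
  rw [Algebra.TensorProduct.one_def]
  simp only [one_eq, map_add, map_sum, comulLin_d, comulLin_e, comulD, comulE, sub_self, mul_zero,
    etaPow_zero, one_smul, TensorProduct.add_tmul, TensorProduct.tmul_add,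
    TensorProduct.sum_tmul, TensorProduct.tmul_sum, Finset.sum_add_distrib, h1, h2, h3, h4]
  abel

lemma mulHom_ext {M : Type*} [Ring M] [Algebra ℂ M] (f : Sekine k →ₗ[ℂ] M)
    (hdd : ∀ i j i' j', f (d k i j * d k i' j') = f (d k i j) * f (d k i' j'))
    (hde : ∀ i j i' j', f (d k i j) * f (e k i' j') = 0)
    (hed : ∀ i j i' j', f (e k i j) * f (d k i' j') = 0)
    (hee : ∀ i j i' j', f (e k i j * e k i' j') = f (e k i j) * f (e k i' j'))
    (x y : Sekine k) : f (x * y) = f x * f y := by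
  have key : (LinearMap.mul ℂ (Sekine k)).compr₂ f = (LinearMap.mul ℂ M).compl₁₂ f f := by
    apply hom_ext
    · intro i j
      apply hom_ext
      · intro i' j'; simpa using hdd i j i' j'
      · intro i' j'; simp [d_mul_e, hde]
    · intro i j
      apply hom_ext
      · intro i' j'; simp [e_mul_d, hed]
      · intro i' j'; simpa using hee i j i' j'
  simpa using congr($key x y)

lemma comul_mul' (x y : Sekine k) : comulLin k (x * y) = comulLin k x * comulLin k y := by
  apply mulHom_ext
  · intro i j i' j'
    rw [d_mul_d, comulLin_d, comulLin_d, comulD_mul_comulD, apply_ite (comulLin k),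
      apply_ite (comulLin k), comulLin_d, map_zero]
  · intro i j i' j'
    rw [comulLin_d, comulLin_e, comulD_mul_comulE]
  · intro i j i' j'
    rw [comulLin_d, comulLin_e, comulE_mul_comulD]
  · intro i j i' j'
    rw [e_mul_e, comulLin_e, comulLin_e, comulE_mul_comulE, apply_ite (comulLin k),
      comulLin_e, map_zero]

lemma counit_mul' (x y : Sekine k) : counitLin k (x * y) = counitLin k x * counitLin k y := by
  apply mulHom_ext
  · intro i j i' j'
    rw [d_mul_d, apply_ite (counitLin k), apply_ite (counitLin k), map_zero, counitLin_d,
      counitLin_d]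
    split_ifs <;> simp_all
  · intro i j i' j'
    rw [counitLin_e, mul_zero]
  · intro i j i' j'
    rw [counitLin_e, zero_mul]
  · intro i j i' j'
    rw [e_mul_e, apply_ite (counitLin k), counitLin_e, counitLin_e, map_zero, zero_mul, ite_self]

lemma counit_one' : counitLin k 1 = 1 := by
  simp only [one_eq, map_add, map_sum, counitLin_d, counitLin_e, Finset.sum_ite_irrel,
    Finset.sum_ite_eq', Finset.mem_univ, if_true, Finset.sum_const_zero, add_zero]

lemma rTensor_counit' : (counitLin k).rTensor (Sekine k) ∘ₗ comulLin k =
    TensorProduct.mk ℂ ℂ (Sekine k) 1 := by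
  apply hom_ext <;> intro i j
  · simp [comulLin_d, comulD, counitLin_d, counitLin_e, TensorProduct.ite_tmul,
      Finset.sum_ite_irrel]
  · simp [comulLin_e, comulE, counitLin_d, counitLin_e, TensorProduct.ite_tmul,
      Finset.sum_ite_irrel, etaPow_zero]

lemma lTensor_counit' : (counitLin k).lTensor (Sekine k) ∘ₗ comulLin k =
    (TensorProduct.mk ℂ (Sekine k) ℂ).flip 1 := by
  apply hom_ext <;> intro i j
  · simp [comulLin_d, comulD, counitLin_d, counitLin_e, TensorProduct.tmul_ite,
      Finset.sum_ite_irrel, sub_eq_zero]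
  · simp [comulLin_e, comulE, counitLin_d, counitLin_e, TensorProduct.tmul_ite,
      Finset.sum_ite_irrel, etaPow_zero]

lemma sum_etaPow_shift (i y : ZMod k) :
    ∑ x, etaPow k (i * (x - y)) = if i = 0 then (k : ℂ) else 0 := by
  rw [← sum_etaPow i, ← sum_shift (-y) fun n => etaPow k (n * i)]
  simp only [sub_eq_add_neg, mul_comm]

lemma sum_etaPow_shift' (i y : ZMod k) :
    ∑ x, etaPow k (i * (y - x)) = if i = 0 then (k : ℂ) else 0 := by
  rw [← sum_etaPow_shift i (-y), ← sum_neg']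
  refine Finset.sum_congr rfl fun x _ => ?_
  congr 1; ring

lemma antipode_right' : LinearMap.mul' ℂ (Sekine k) ∘ₗ (antipodeLin k).rTensor (Sekine k) ∘ₗ
    comulLin k = Algebra.linearMap ℂ (Sekine k) ∘ₗ counitLin k := by
  apply hom_ext <;> intro i j
  · simp only [LinearMap.comp_apply, comulLin_d, comulD, map_add, map_sum, map_smul,
      LinearMap.rTensor_tmul, LinearMap.mul'_apply, antipodeLin_d, antipodeLin_e, counitLin_d,
      d_mul_d, e_mul_e]
    have hc : ∀ x y : ZMod k, (-x = y - x) = (y = 0) := fun x y => by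
      rw [eq_iff_iff]
      exact ⟨fun h => by linear_combination -h, fun h => by rw [h, zero_sub]⟩
    simp only [hc, left_eq_add]
    by_cases hj : j = 0
    · subst hj
      rw [Finset.sum_comm (f := fun x x_1 => etaPow k (i * (x - x_1)) • _)]
      simp only [if_true, add_zero, ← Finset.sum_smul, sum_etaPow_shift]
      by_cases hi : i = 0
      · simp only [hi, if_true, ← Finset.smul_sum, smul_smul]
        rw [one_div, inv_mul_cancel₀ k_ne_zero, one_smul, Algebra.linearMap_apply, map_one, one_eq,
          sum_neg' fun x => ∑ x_1, d k x (-x_1)]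
        congr 1
        exact Finset.sum_congr rfl fun x _ => sum_neg' fun y => d k x y
      · simp [hi]
    · simp [hj]
  · simp [comulLin_e, comulE, antipodeLin_d, antipodeLin_e, counitLin_e, d_mul_e, e_mul_d]

lemma antipode_left' : LinearMap.mul' ℂ (Sekine k) ∘ₗ (antipodeLin k).lTensor (Sekine k) ∘ₗ
    comulLin k = Algebra.linearMap ℂ (Sekine k) ∘ₗ counitLin k := by
  apply hom_ext <;> intro i j
  · simp only [LinearMap.comp_apply, comulLin_d, comulD, map_add, map_sum, map_smul,
      LinearMap.lTensor_tmul, LinearMap.mul'_apply, antipodeLin_d, antipodeLin_e, counitLin_d,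
      d_mul_d, e_mul_e]
    have hc : ∀ x y : ZMod k, (x = -(y - x)) = (y = 0) := fun x y => by
      rw [eq_iff_iff]
      exact ⟨fun h => by linear_combination h, fun h => by rw [h, zero_sub, neg_neg]⟩
    simp only [hc, left_eq_add]
    by_cases hj : j = 0
    · subst hj
      simp only [if_true, add_zero, ← Finset.sum_smul, sum_etaPow_shift']
      by_cases hi : i = 0
      · simp only [hi, if_true, ← Finset.smul_sum, smul_smul]
        rw [one_div, inv_mul_cancel₀ k_ne_zero, one_smul, Algebra.linearMap_apply, map_one, one_eq]
      · simp [hi]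
    · simp [hj]
  · simp [comulLin_e, comulE, antipodeLin_d, antipodeLin_e, counitLin_e, d_mul_e, e_mul_d]

lemma coassoc' : TensorProduct.assoc ℂ (Sekine k) (Sekine k) (Sekine k) ∘ₗ
    (comulLin k).rTensor (Sekine k) ∘ₗ comulLin k =
      (comulLin k).lTensor (Sekine k) ∘ₗ comulLin k := by
  apply hom_ext
  · intro i j
    simp only [LinearMap.comp_apply, comulLin_d, comulLin_e, comulD, comulE, map_add, map_sum,
      map_smul, LinearMap.rTensor_tmul, LinearMap.lTensor_tmul, TensorProduct.add_tmul,
      TensorProduct.tmul_add, TensorProduct.sum_tmul, TensorProduct.tmul_sum,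
      ← TensorProduct.smul_tmul', TensorProduct.tmul_smul, LinearEquiv.coe_coe,
      TensorProduct.assoc_tmul, smul_add, Finset.sum_add_distrib, Finset.smul_sum, smul_smul]
    have reorder : ∀ {a b c d a' b' c' d' : Sekine k ⊗[ℂ] (Sekine k ⊗[ℂ] Sekine k)},
        a = a' → b = d' → c = b' → d = c' → a + b + (c + d) = a' + b' + (c' + d') := by
      rintro a b c d _ _ _ _ rfl rfl rfl rfl; abel
    apply reorder
    · refine sum4_reindex _ _
        { toFun := fun p => (p.2.2.1, p.2.2.2, p.1 - p.2.2.1, p.2.1 - p.2.2.2)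
          invFun := fun p => (p.2.2.1 + p.1, p.2.2.2 + p.2.1, p.1, p.2.1)
          left_inv := fun p => by simp
          right_inv := fun p => by simp } fun p => ?_
      simp only [Equiv.coe_fn_mk, mul_assoc, etaPow_mul]; ring_nf
    · refine sum4_reindex _ _
        { toFun := fun p => (p.2.2.1, p.2.2.2, i - p.1, j - p.2.1)
          invFun := fun p => (i - p.2.2.1, j - p.2.2.2, p.1, p.2.1)
          left_inv := fun p => by simp
          right_inv := fun p => by simp } fun p => ?_
      simp only [Equiv.coe_fn_mk, mul_assoc, etaPow_mul]; ring_nf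
    · refine sum4_reindex _ _
        { toFun := fun p => (-p.2.2.1, -p.2.2.2, p.1 - p.2.2.2, p.2.1 - p.2.2.2)
          invFun := fun p => (p.2.2.1 - p.2.1, p.2.2.2 - p.2.1, -p.1, -p.2.1)
          left_inv := fun p => by simp
          right_inv := fun p => by simp } fun p => ?_
      simp only [Equiv.coe_fn_mk, mul_assoc, etaPow_mul]; ring_nf
    · refine sum4_reindex _ _
        { toFun := fun p => (p.1 - p.2.2.2, p.2.1 - p.2.2.2, -p.2.2.1, -p.2.2.2)
          invFun := fun p => (p.1 - p.2.2.2, p.2.1 - p.2.2.2, -p.2.2.1, -p.2.2.2)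
          left_inv := fun p => by simp
          right_inv := fun p => by simp } fun p => ?_
      simp only [Equiv.coe_fn_mk, mul_assoc, etaPow_mul]; ring_nf
  · intro i j
    simp only [LinearMap.comp_apply, comulLin_d, comulLin_e, comulD, comulE, map_add, map_sum,
      map_smul, LinearMap.rTensor_tmul, LinearMap.lTensor_tmul, TensorProduct.add_tmul,
      TensorProduct.tmul_add, TensorProduct.sum_tmul, TensorProduct.tmul_sum,
      ← TensorProduct.smul_tmul', TensorProduct.tmul_smul, LinearEquiv.coe_coe,
      TensorProduct.assoc_tmul, smul_add, Finset.sum_add_distrib, Finset.smul_sum, smul_smul]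
    have reorder : ∀ {a b c d a' b' c' d' : Sekine k ⊗[ℂ] (Sekine k ⊗[ℂ] Sekine k)},
        a = a' → b = d' → c = b' → d = c' → a + b + (c + d) = a' + b' + (c' + d') := by
      rintro a b c d _ _ _ _ rfl rfl rfl rfl; abel
    apply reorder
    · refine sum4_reindex _ _
        { toFun := fun p => (-p.2.2.1, -p.2.2.2, p.1 + p.2.2.1, p.2.1 + p.2.2.2)
          invFun := fun p => (p.2.2.1 + p.1, p.2.2.2 + p.2.1, -p.1, -p.2.1)
          left_inv := fun p => by simp
          right_inv := fun p => by simp } fun p => ?_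
      simp only [Equiv.coe_fn_mk, mul_assoc, etaPow_mul]; ring_nf
    · trans ∑ a, ∑ y, e k y (y - (i - j)) ⊗ₜ[ℂ]
          (e k (y + -a) (y - (i - j) + -a) ⊗ₜ[ℂ] e k (i - a) (j - a))
      · refine sum4_collapse (i - j) _ (fun y z => (i - j) - (y - z)) ?_ ?_
          (fun a y z => e k y z ⊗ₜ[ℂ] (e k (y + -a) (z + -a) ⊗ₜ[ℂ] e k (i - a) (j - a)))
        · intro x y z
          rw [mul_left_comm, etaPow_mul]; ring_nf
        · intro y z
          constructor
          · intro h; linear_combination -h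
          · intro h; linear_combination -h
      · symm
        trans ∑ a, ∑ y, e k (i - a) (j - a) ⊗ₜ[ℂ]
          (e k y (y - (i - j)) ⊗ₜ[ℂ] e k (y + a) (y - (i - j) + a))
        · refine sum4_collapse (i - j) _ (fun y z => (y - z) - (i - j)) ?_ ?_
            (fun a y z => e k (i - a) (j - a) ⊗ₜ[ℂ] (e k y z ⊗ₜ[ℂ] e k (y + a) (z + a)))
          · intro x y z
            rw [mul_left_comm, etaPow_mul]; ring_nf
          · intro y z
            constructor
            · intro h; linear_combination h
            · intro h; linear_combination h
        · refine sum2_reindex _ _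
            { toFun := fun p => (i - p.1 - p.2, i - p.1)
              invFun := fun p => (i - p.2, p.2 - p.1)
              left_inv := fun p => by simp
              right_inv := fun p => by simp } fun p => ?_
          simp only [Equiv.coe_fn_mk]; ring_nf
    · refine sum4_reindex _ _
        { toFun := fun p => (p.2.2.1, p.2.2.2, p.1, p.2.1)
          invFun := fun p => (p.2.2.1, p.2.2.2, p.1, p.2.1)
          left_inv := fun p => by simp
          right_inv := fun p => by simp } fun p => ?_
      simp only [Equiv.coe_fn_mk, mul_assoc, etaPow_mul]; ring_nf
    · refine sum4_reindex _ _
        { toFun := fun p => (p.1 + p.2.2.1, p.2.1 + p.2.2.2, p.2.2.1, p.2.2.2)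
          invFun := fun p => (p.1 - p.2.2.1, p.2.1 - p.2.2.2, p.2.2.1, p.2.2.2)
          left_inv := fun p => by simp
          right_inv := fun p => by simp } fun p => ?_
      simp only [Equiv.coe_fn_mk, mul_assoc, etaPow_mul]; ring_nf

end Structure

instance : Coalgebra ℂ (Sekine k) where
  comul := comulLin k
  counit := counitLin k
  coassoc := coassoc'
  rTensor_counit_comp_comul := rTensor_counit'
  lTensor_counit_comp_comul := lTensor_counit'

instance : Bialgebra ℂ (Sekine k) :=
  Bialgebra.mk' ℂ (Sekine k) counit_one' (counit_mul' _ _) comul_one' (comul_mul' _ _)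

instance : HopfAlgebra ℂ (Sekine k) where
  antipode := antipodeLin k
  mul_antipode_rTensor_comul := antipode_right'
  mul_antipode_lTensor_comul := antipode_left'

/-- The subspace `L'_i`, spanned by the elements `∑_{(r,s) ∈ Γ_i} d_{p-r,q-s}` and
`∑_{(r,s) ∈ Γ_i} η^{r(q-p)} e_{p-s,q-s}` with `p, q ∈ ℤ/k`, where
`Γ_i = {(r, i r) | r ∈ ℤ/k}`. -/
def coidealL (i : ZMod k) : Submodule ℂ (Sekine k) :=
  Submodule.span ℂ
    (Set.range (fun pq : ZMod k × ZMod k => ∑ r, d k (pq.1 - r) (pq.2 - i * r)) ∪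
      Set.range (fun pq : ZMod k × ZMod k =>
        ∑ r, etaPow k (r * (pq.2 - pq.1)) • e k (pq.1 - i * r) (pq.2 - i * r)))

/-- The subspace `L'_k`, spanned by `∑_{r,s} d_{r,s}` and `∑_s e_{s,s}`. -/
def coidealTop : Submodule ℂ (Sekine k) :=
  Submodule.span ℂ {∑ r, ∑ s, d k r s, ∑ s, e k s s}

end Sekine

end

/-! Write an element of the algebra through its coefficients: a function on `ZMod k × ZMod k` and a
matrix. Products are then pointwise and matrix products, and the counit is evaluation of the
function at `(0, 0)`. Semisimplicity is immediate, the algebra being a finite product of copies of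
`ℂ` and one full matrix algebra.

The space `L'_i` consists of the elements that are covariant under translation: the function is
invariant under the subgroup `Γ_i`, and translating both matrix indices by `i * t` multiplies an
entry by a power of `η` (`coord_of_mem_coidealL`, `mem_coidealL_of_coord`). In this form, containing
`1`, closure under products and stability under the adjoint action are short computations. The
integral of `L'_i` is the indicator function of `Γ_i`, with zero matrix part; that of `L'_k` is the
unit of the commutative summand.

If `l` has zero matrix part, then `A l` lies in the commutative summand, so `A l` is commutative and
every `x * l` is central in it (`mul_mem_centerOf`). Hence the only nilpotency condition with
content is the first: `L'_k` must be central in `A`, and it is spanned by the units of the two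
summands.

For solvability the chain `ℂ1 ⊆ L'_0 ⊆ A` works for every `k`. On the commutative summand `A` acts
through the counit (`dCoord_adAction`), and multiplying by the integral of `L'_0` discards the
matrix part, which settles the upper step. For the lower step, elements of `L'_0` have diagonal
matrix part, and Fourier inversion on `ZMod k` shows that `L'_0` acts trivially on itself
(`adAction_of_mem_coidealL_zero`). -/

noncomputable section

/-! ### The adjoint action and the trivial left coideal subalgebras -/

section HopfGeneral

variable {A : Type*} [Ring A] [HopfAlgebra ℂ A]

/-- The adjoint action on a fixed element, as a linear map. -/
def adActionFlip (b : A) : A →ₗ[ℂ] A :=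
  LinearMap.mul' ℂ A ∘ₗ
    TensorProduct.map (LinearMap.mulRight ℂ b) (HopfAlgebra.antipode ℂ) ∘ₗ Coalgebra.comul

lemma adActionFlip_apply (a b : A) : adActionFlip b a = adAction a b := rfl

/-- A central `x` can be pulled to the front of `a₍₁₎ x S(a₍₂₎)`, leaving the antipode identity
`a₍₁₎ S(a₍₂₎) = ε(a)`. -/
lemma adAction_of_central (a : A) {x : A} (hx : ∀ y, x * y = y * x) :
    adAction a x = Coalgebra.counit (R := ℂ) a • x := by
  have h : LinearMap.mul' ℂ A ∘ₗ
      TensorProduct.map (LinearMap.mulRight ℂ x) (HopfAlgebra.antipode ℂ) =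
      LinearMap.mulLeft ℂ x ∘ₗ LinearMap.mul' ℂ A ∘ₗ
        (HopfAlgebra.antipode ℂ).lTensor A := by
    refine TensorProduct.ext' fun y z => ?_
    simp [← hx, mul_assoc]
  have h' := LinearMap.congr_fun h (Coalgebra.comul a)
  simp only [LinearMap.comp_apply, HopfAlgebra.mul_antipode_lTensor_comul_apply,
    LinearMap.mulLeft_apply] at h'
  rw [adAction, h', ← Algebra.commutes, Algebra.smul_def]

lemma tmul_mem_range_lTensor {L : Submodule ℂ A} (a : A) {x : A} (hx : x ∈ L) :
    a ⊗ₜ[ℂ] x ∈ LinearMap.range (L.subtype.lTensor A) :=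
  ⟨a ⊗ₜ ⟨x, hx⟩, by simp⟩

lemma isLeftCoidealSubalgebra_top : IsLeftCoidealSubalgebra (⊤ : Submodule ℂ A) where
  one_mem := trivial
  mul_mem _ _ _ _ := trivial
  comul_mem x _ := by
    induction Coalgebra.comul (R := ℂ) x using TensorProduct.induction_on with
    | zero => exact zero_mem _
    | tmul a b => exact tmul_mem_range_lTensor a trivial
    | add a b ha hb => exact add_mem ha hb

lemma isLeftCoidealSubalgebra_span_one :
    IsLeftCoidealSubalgebra (Submodule.span ℂ {(1 : A)}) where
  one_mem := Submodule.mem_span_singleton_self 1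
  mul_mem x hx y hy := by
    obtain ⟨c, rfl⟩ := Submodule.mem_span_singleton.1 hx
    rw [smul_one_mul]
    exact Submodule.smul_mem _ _ hy
  comul_mem x hx := by
    obtain ⟨c, rfl⟩ := Submodule.mem_span_singleton.1 hx
    rw [map_smul, Bialgebra.comul_one, Algebra.TensorProduct.one_def]
    exact Submodule.smul_mem _ _ (tmul_mem_range_lTensor 1 (Submodule.mem_span_singleton_self 1))

lemma isAdNormal_of_central {L : Submodule ℂ A} (h : ∀ x ∈ L, ∀ y, x * y = y * x) :
    IsAdNormal L := fun a x hx => by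
  rw [adAction_of_central a (h x hx)]
  exact Submodule.smul_mem _ _ hx

lemma central_of_mem_span {s : Set A} (h : ∀ x ∈ s, ∀ y, x * y = y * x) :
    ∀ x ∈ Submodule.span ℂ s, ∀ y, x * y = y * x := fun x hx y => by
  induction hx using Submodule.span_induction with
  | mem x hx => exact h x hx y
  | zero => simp
  | add a b _ _ ha hb => rw [add_mul, mul_add, ha, hb]
  | smul c a _ ha => rw [smul_mul_assoc, mul_smul_comm, ha]

lemma isNormalizedIntegral_one :
    IsNormalizedIntegral (Submodule.span ℂ {(1 : A)}) 1 where
  mem := Submodule.mem_span_singleton_self 1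
  mul_left x hx := by
    obtain ⟨c, rfl⟩ := Submodule.mem_span_singleton.1 hx
    simp
  mul_right x hx := by
    obtain ⟨c, rfl⟩ := Submodule.mem_span_singleton.1 hx
    simp
  counit_eq_one := Bialgebra.counit_one

end HopfGeneral

/-! ### Coordinates, and the adjoint action in coordinates -/

namespace Sekine

variable {k : ℕ} [NeZero k]

/-- The coefficient of `d_{ab}`. -/
def dCoord (a b : ZMod k) : Sekine k →ₗ[ℂ] ℂ where
  toFun x := x.1 (a, b)
  map_add' _ _ := rfl
  map_smul' _ _ := rfl

/-- The coefficient of `e_{ab}`. -/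
def eCoord (a b : ZMod k) : Sekine k →ₗ[ℂ] ℂ where
  toFun x := x.2 a b
  map_add' _ _ := rfl
  map_smul' _ _ := rfl

lemma ext_coord {x y : Sekine k} (hd : ∀ a b, dCoord a b x = dCoord a b y)
    (he : ∀ a b, eCoord a b x = eCoord a b y) : x = y :=
  Prod.ext (funext fun p => hd p.1 p.2) (Matrix.ext he)

lemma dCoord_d (a b i j : ZMod k) : dCoord a b (d k i j) = if i = a ∧ j = b then 1 else 0 := by
  change (Pi.single (i, j) 1 : ZMod k × ZMod k → ℂ) (a, b) = _
  simp [Pi.single_apply, eq_comm]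

lemma dCoord_e (a b i j : ZMod k) : dCoord a b (e k i j) = 0 := rfl

lemma eCoord_d (a b i j : ZMod k) : eCoord a b (d k i j) = 0 := rfl

lemma eCoord_e (a b i j : ZMod k) : eCoord a b (e k i j) = if i = a ∧ j = b then 1 else 0 := by
  change Matrix.single i j (1 : ℂ) a b = _
  simp [Matrix.single_apply]

lemma dCoord_mul (a b : ZMod k) (x y : Sekine k) :
    dCoord a b (x * y) = dCoord a b x * dCoord a b y := rfl

lemma eCoord_mul (a b : ZMod k) (x y : Sekine k) :
    eCoord a b (x * y) = ∑ c, eCoord a c x * eCoord c b y := rfl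

lemma dCoord_one (a b : ZMod k) : dCoord a b (1 : Sekine k) = 1 := rfl

lemma eCoord_one (a b : ZMod k) : eCoord a b (1 : Sekine k) = if a = b then 1 else 0 :=
  Matrix.one_apply

lemma eq_sum_coord (x : Sekine k) :
    x = (∑ i, ∑ j, dCoord i j x • d k i j) + ∑ i, ∑ j, eCoord i j x • e k i j := eq_sum x

lemma counit_eq_dCoord (x : Sekine k) : Coalgebra.counit (R := ℂ) x = dCoord 0 0 x := by
  have : counitLin k = dCoord 0 0 := by
    refine hom_ext (fun i j => ?_) fun i j => ?_
    · rw [counitLin_d, dCoord_d, ite_and]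
    · rw [counitLin_e, dCoord_e]
  exact LinearMap.congr_fun this x

lemma d_mul_mul_d (i j i' j' : ZMod k) (x : Sekine k) :
    d k i j * x * d k i' j' = if i = i' ∧ j = j' then dCoord i j x • d k i j else 0 := by
  refine ext_coord (fun a b => ?_) fun a b => ?_
  · simp only [dCoord_mul, dCoord_d]
    split_ifs <;> simp_all [dCoord_d]
  · simp only [eCoord_mul, eCoord_d]
    split_ifs <;> simp [eCoord_d]

lemma e_mul_mul_e (i j i' j' : ZMod k) (x : Sekine k) :
    e k i j * x * e k i' j' = eCoord j i' x • e k i j' := by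
  refine ext_coord (fun a b => ?_) fun a b => ?_
  · simp [dCoord_mul, dCoord_e]
  · simp only [eCoord_mul, eCoord_e, map_smul, ite_and, ite_mul, mul_ite, one_mul, mul_one,
      zero_mul, mul_zero, smul_eq_mul, Finset.sum_ite_eq, Finset.mem_univ, if_true]
    split_ifs <;> simp

lemma d_mul_mul_e (i j i' j' : ZMod k) (x : Sekine k) : d k i j * x * e k i' j' = 0 := by
  refine ext_coord (fun a b => ?_) fun a b => ?_ <;>
  simp [dCoord_mul, dCoord_e, eCoord_mul, eCoord_d]

lemma e_mul_mul_d (i j i' j' : ZMod k) (x : Sekine k) : e k i j * x * d k i' j' = 0 := by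
  refine ext_coord (fun a b => ?_) fun a b => ?_ <;>
  simp [dCoord_mul, dCoord_e, eCoord_mul, eCoord_d]

/-- Since `S(d_{i-m,j-n}) = d_{m-i,n-j}`, the factors around `x` are orthogonal unless `i = j = 0`.
In the matrix summand `e_{mn} x e_{n+j,m+j}` picks out the entry `x_{n,n+j}`. -/
lemma adAction_d (i j : ZMod k) (x : Sekine k) :
    adAction (d k i j) x = (∑ m, ∑ n, if i = 0 ∧ j = 0 then dCoord m n x • d k m n else 0) +
      (1 / (k : ℂ)) • ∑ m, ∑ n, etaPow k (i * (m - n)) • eCoord n (n + j) x • e k m (m + j) := by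
  have hc : ∀ m n : ZMod k, (m = -(i - m) ∧ n = -(j - n)) = (i = 0 ∧ j = 0) := fun m n => by
    simp [neg_sub, eq_comm (a := m), eq_comm (a := n)]
  change LinearMap.mul' ℂ _ (TensorProduct.map (LinearMap.mulRight ℂ x) (antipodeLin k)
    (comulLin k (d k i j))) = _
  simp only [comulLin_d, comulD, map_add, map_sum, map_smul, TensorProduct.map_tmul,
    LinearMap.mul'_apply, LinearMap.mulRight_apply, antipodeLin_d, antipodeLin_e, d_mul_mul_d,
    e_mul_mul_e, hc]

/-- Each term of `Δ(e_{ij})` has one leg in each summand and `S` preserves the summands, so `x` is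
always sandwiched between orthogonal ideals. -/
lemma adAction_e (i j : ZMod k) (x : Sekine k) : adAction (e k i j) x = 0 := by
  change LinearMap.mul' ℂ _ (TensorProduct.map (LinearMap.mulRight ℂ x) (antipodeLin k)
    (comulLin k (e k i j))) = _
  simp [comulLin_e, comulE, antipodeLin_d, antipodeLin_e, d_mul_mul_e, e_mul_mul_d]

lemma dCoord_adAction (a b : ZMod k) (x y : Sekine k) :
    dCoord a b (adAction x y) = dCoord 0 0 x * dCoord a b y := by
  suffices h : dCoord a b ∘ₗ adActionFlip y = dCoord a b y • dCoord 0 0 by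
    rw [mul_comm]
    exact LinearMap.congr_fun h x
  refine hom_ext (fun i j => ?_) fun i j => ?_
  · simp only [LinearMap.comp_apply, adActionFlip_apply, adAction_d, LinearMap.smul_apply]
    by_cases h : i = 0 ∧ j = 0 <;>
    simp [h, dCoord_d, dCoord_e, ite_and]
  · simp [adActionFlip_apply, adAction_e, dCoord_e]

/-- The action preserves each diagonal `b - a = const`, and on the diagonal `j` the element `d_{ij}`
acts as the Fourier projection onto frequency `i`. -/
lemma eCoord_adAction (a b : ZMod k) (x y : Sekine k) :
    eCoord a b (adAction x y) = (1 / (k : ℂ)) * ∑ i, dCoord i (b - a) x *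
      ∑ n, etaPow k (i * (a - n)) * eCoord n (n + (b - a)) y := by
  suffices h : eCoord a b ∘ₗ adActionFlip y = (1 / (k : ℂ)) • ∑ i,
      (∑ n, etaPow k (i * (a - n)) * eCoord n (n + (b - a)) y) • dCoord i (b - a) by
    have := LinearMap.congr_fun h x
    simp only [LinearMap.smul_apply, LinearMap.sum_apply, smul_eq_mul] at this
    simp only [mul_comm (dCoord _ _ x)]
    exact this
  refine hom_ext (fun i j => ?_) fun i j => ?_
  · simp only [LinearMap.comp_apply, adActionFlip_apply, adAction_d, LinearMap.smul_apply,
      LinearMap.sum_apply, dCoord_d, map_add, map_sum, map_smul, eCoord_e, smul_eq_mul,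
      apply_ite (eCoord a b), eCoord_d, mul_zero, map_zero, ite_self, Finset.sum_const_zero,
      zero_add, ite_and]
    congr 1
    -- The matrix unit `e_{m,m+j}` has a nonzero `(a, b)` entry only for `m = a` and `j = b - a`.
    rw [Finset.sum_eq_single a (fun c _ hc => by simp [hc]) (by simp)]
    by_cases h : j = b - a
    · subst h; simp
    · have : a + j ≠ b := fun h' => h (by rw [← h']; ring)
      simp [h, this]
  · simp [adActionFlip_apply, adAction_e, dCoord_e]

end Sekine
-- The subspaces `L'_i`: normality, coideal property and integrals
namespace Sekine

variable {k : ℕ} [NeZero k]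

/-- The spanning element `∑_r d_{p-r,q-ir}` of `L'_i`. -/
def coidealD (i p q : ZMod k) : Sekine k := ∑ r, d k (p - r) (q - i * r)

/-- The spanning element `∑_r η^{r(q-p)} e_{p-ir,q-ir}` of `L'_i`. -/
def coidealE (i p q : ZMod k) : Sekine k :=
  ∑ r, etaPow k (r * (q - p)) • e k (p - i * r) (q - i * r)

lemma coidealD_mem (i p q : ZMod k) : coidealD i p q ∈ coidealL k i :=
  Submodule.subset_span (Or.inl ⟨(p, q), rfl⟩)

lemma coidealE_mem (i p q : ZMod k) : coidealE i p q ∈ coidealL k i :=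
  Submodule.subset_span (Or.inr ⟨(p, q), rfl⟩)

lemma coidealL_induction {i : ZMod k} {P : Sekine k → Prop}
    (hD : ∀ p q, P (coidealD i p q)) (hE : ∀ p q, P (coidealE i p q)) (h0 : P 0)
    (hadd : ∀ x y, P x → P y → P (x + y)) (hsmul : ∀ (c : ℂ) x, P x → P (c • x))
    {x : Sekine k} (hx : x ∈ coidealL k i) : P x := by
  induction hx using Submodule.span_induction with
  | mem x hx =>
    obtain ⟨⟨p, q⟩, rfl⟩ | ⟨⟨p, q⟩, rfl⟩ := hx
    · exact hD p q
    · exact hE p q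
  | zero => exact h0
  | add x y _ _ hx hy => exact hadd x y hx hy
  | smul c x _ hx => exact hsmul c x hx

/-- The relations are linear, and on a spanning element they amount to the substitution `r ↦ r + t`
in its defining sum. -/
lemma coord_of_mem_coidealL {i : ZMod k} {x : Sekine k} (hx : x ∈ coidealL k i) :
    (∀ t a b, dCoord (a - t) (b - i * t) x = dCoord a b x) ∧
      ∀ t a b, eCoord (a - i * t) (b - i * t) x = etaPow k (t * (b - a)) * eCoord a b x := by
  refine coidealL_induction (P := fun x =>
      (∀ t a b, dCoord (a - t) (b - i * t) x = dCoord a b x) ∧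
      ∀ t a b, eCoord (a - i * t) (b - i * t) x = etaPow k (t * (b - a)) * eCoord a b x)
    (fun p q => ⟨fun t a b => ?_, fun t a b => ?_⟩)
    (fun p q => ⟨fun t a b => ?_, fun t a b => ?_⟩) (by simp)
    (fun x y hx hy => ⟨fun t a b => ?_, fun t a b => ?_⟩)
    (fun c x hx => ⟨fun t a b => ?_, fun t a b => ?_⟩) hx
  · simp only [coidealD, map_sum, dCoord_d]
    rw [← sum_shift t]
    refine Finset.sum_congr rfl fun r _ => if_congr (and_congr ?_ ?_) rfl rfl
    · rw [← sub_sub, sub_left_inj]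
    · rw [mul_add, ← sub_sub, sub_left_inj]
  · simp [coidealD, eCoord_d]
  · simp [coidealE, dCoord_e]
  · simp only [coidealE, map_sum, map_smul, eCoord_e, smul_eq_mul, Finset.mul_sum]
    rw [← sum_shift t]
    refine Finset.sum_congr rfl fun r _ => ?_
    simp only [mul_add, ← sub_sub, sub_left_inj]
    split_ifs with h
    · rw [← h.1, ← h.2, mul_one, mul_one, etaPow_mul]
      congr 1; ring
    · simp
  · rw [map_add, map_add, hx.1, hy.1]
  · rw [map_add, map_add, hx.2, hy.2, mul_add]
  · rw [map_smul, map_smul, hx.1]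
  · rw [map_smul, map_smul, hx.2, smul_eq_mul, smul_eq_mul, mul_left_comm]

/-- Replacing each basis vector by its spanning element averages `x` over translations. A covariant
`x` is fixed by this average up to the factor `k`, which exhibits it as a combination of spanning
elements. -/
lemma mem_coidealL_of_coord {i : ZMod k} {x : Sekine k}
    (hd : ∀ t a b, dCoord (a - t) (b - i * t) x = dCoord a b x)
    (he : ∀ t a b, eCoord (a - i * t) (b - i * t) x = etaPow k (t * (b - a)) * eCoord a b x) :
    x ∈ coidealL k i := by
  have hD : ∑ p, ∑ q, dCoord p q x • coidealD i p q =
      (k : ℂ) • ∑ p, ∑ q, dCoord p q x • d k p q := by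
    trans ∑ p, ∑ q, ∑ _r : ZMod k, dCoord p q x • d k p q
    · simp only [coidealD, Finset.smul_sum]
      refine sum3_reindex _ _
        { toFun := fun t => (t.1 - t.2.2, t.2.1 - i * t.2.2, t.2.2)
          invFun := fun t => (t.1 + t.2.2, t.2.1 + i * t.2.2, t.2.2)
          left_inv := fun t => by simp
          right_inv := fun t => by simp } fun t => ?_
      simp only [Equiv.coe_fn_mk, hd]
    · simp only [Finset.sum_const, Finset.card_univ, ZMod.card, Finset.smul_sum,
        Nat.cast_smul_eq_nsmul]
  have hE : ∑ p, ∑ q, eCoord p q x • coidealE i p q =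
      (k : ℂ) • ∑ p, ∑ q, eCoord p q x • e k p q := by
    trans ∑ p, ∑ q, ∑ _r : ZMod k, eCoord p q x • e k p q
    · simp only [coidealE, Finset.smul_sum]
      refine sum3_reindex _ _
        { toFun := fun t => (t.1 - i * t.2.2, t.2.1 - i * t.2.2, t.2.2)
          invFun := fun t => (t.1 + i * t.2.2, t.2.1 + i * t.2.2, t.2.2)
          left_inv := fun t => by simp
          right_inv := fun t => by simp } fun t => ?_
      simp only [Equiv.coe_fn_mk, he, smul_smul, mul_comm]
    · simp only [Finset.sum_const, Finset.card_univ, ZMod.card, Finset.smul_sum,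
        Nat.cast_smul_eq_nsmul]
  have hx : x = (1 / (k : ℂ)) • (∑ p, ∑ q, dCoord p q x • coidealD i p q +
      ∑ p, ∑ q, eCoord p q x • coidealE i p q) := by
    rw [hD, hE, ← smul_add, ← eq_sum_coord, smul_smul, one_div, inv_mul_cancel₀ k_ne_zero,
      one_smul]
  rw [hx]
  exact Submodule.smul_mem _ _ (add_mem
    (sum_mem fun p _ => sum_mem fun q _ => Submodule.smul_mem _ _ (coidealD_mem i p q))
    (sum_mem fun p _ => sum_mem fun q _ => Submodule.smul_mem _ _ (coidealE_mem i p q)))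

/-- The summation over `r` can be moved entirely into the second leg. In the matrix part the phase
`η^{-r(m-n)}` coming from `p - r` is exactly the weight in `coidealE`. -/
lemma comul_coidealD (i p q : ZMod k) :
    comulLin k (coidealD i p q) =
      (∑ m, ∑ n, d k m n ⊗ₜ[ℂ] coidealD i (p - m) (q - n)) +
      (1 / (k : ℂ)) • ∑ m, ∑ n,
        etaPow k (p * (m - n)) • (e k m n ⊗ₜ[ℂ] coidealE i (m + q) (n + q)) := by
  simp only [coidealD, coidealE, map_sum, comulLin_d, comulD, Finset.sum_add_distrib,
    TensorProduct.tmul_sum, ← Finset.smul_sum]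
  congr 1
  · rw [Finset.sum_comm]
    refine Finset.sum_congr rfl fun m _ => ?_
    rw [Finset.sum_comm]
    refine Finset.sum_congr rfl fun n _ => Finset.sum_congr rfl fun r _ => ?_
    congr 2 <;> ring
  · congr 1
    rw [Finset.sum_comm]
    refine Finset.sum_congr rfl fun m _ => ?_
    rw [Finset.sum_comm]
    refine Finset.sum_congr rfl fun n _ => ?_
    rw [Finset.smul_sum]
    refine Finset.sum_congr rfl fun r _ => ?_
    rw [TensorProduct.tmul_smul, smul_smul, etaPow_mul]
    ring_nf

lemma comul_coidealE (i p q : ZMod k) :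
    comulLin k (coidealE i p q) =
      (∑ m, ∑ n, etaPow k (m * (p - q)) • (d k (-m) (-n) ⊗ₜ[ℂ] coidealE i (p - n) (q - n))) +
      ∑ m, ∑ n, etaPow k (m * (q - p)) • (e k (p - n) (q - n) ⊗ₜ[ℂ] coidealD i m n) := by
  simp only [coidealD, coidealE, map_sum, map_smul, comulLin_e, comulE, smul_add,
    Finset.sum_add_distrib, TensorProduct.tmul_sum, Finset.smul_sum]
  congr 1
  · rw [Finset.sum_comm]
    refine Finset.sum_congr rfl fun m _ => ?_
    rw [Finset.sum_comm]
    refine Finset.sum_congr rfl fun n _ => Finset.sum_congr rfl fun r _ => ?_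
    rw [TensorProduct.tmul_smul, smul_smul, smul_smul, etaPow_mul, etaPow_mul]
    ring_nf
  · trans ∑ r : ZMod k, ∑ m : ZMod k, ∑ n : ZMod k,
      etaPow k (m * (q - p)) • e k (p - n) (q - n) ⊗ₜ[ℂ] d k (m - r) (n - i * r)
    -- Shifting `(m, n)` by `(r, i * r)` frees the first leg of `r`, and the shift of `m` absorbs
    -- the phase `η^{r(q-p)}`.
    · refine sum3_reindex _ _
        { toFun := fun t => (t.1, t.2.1 + t.1, t.2.2 + i * t.1)
          invFun := fun t => (t.1, t.2.1 - t.1, t.2.2 - i * t.1)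
          left_inv := fun t => by simp
          right_inv := fun t => by simp } fun t => ?_
      simp only [Equiv.coe_fn_mk, smul_smul, etaPow_mul]
      ring_nf
    · rw [Finset.sum_comm]
      refine Finset.sum_congr rfl fun m _ => ?_
      rw [Finset.sum_comm]

lemma comul_mem_of_mem_coidealL {i : ZMod k} {x : Sekine k} (hx : x ∈ coidealL k i) :
    Coalgebra.comul (R := ℂ) x ∈ LinearMap.range ((coidealL k i).subtype.lTensor (Sekine k)) := by
  change comulLin k x ∈ _
  refine coidealL_induction (P := fun x => comulLin k x ∈
      LinearMap.range ((coidealL k i).subtype.lTensor (Sekine k)))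
    (fun p q => ?_) (fun p q => ?_) (by rw [map_zero]; exact zero_mem _)
    (fun x y hx hy => ?_) (fun c x hx => ?_) hx
  · rw [comul_coidealD]
    exact add_mem
      (sum_mem fun m _ => sum_mem fun n _ => tmul_mem_range_lTensor _ (coidealD_mem _ _ _))
      (Submodule.smul_mem _ _ <| sum_mem fun m _ => sum_mem fun n _ =>
        Submodule.smul_mem _ _ <| tmul_mem_range_lTensor _ (coidealE_mem _ _ _))
  · rw [comul_coidealE]
    exact add_mem
      (sum_mem fun m _ => sum_mem fun n _ =>
        Submodule.smul_mem _ _ <| tmul_mem_range_lTensor _ (coidealE_mem _ _ _))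
      (sum_mem fun m _ => sum_mem fun n _ =>
        Submodule.smul_mem _ _ <| tmul_mem_range_lTensor _ (coidealD_mem _ _ _))
  · rw [map_add]; exact add_mem hx hy
  · rw [map_smul]; exact Submodule.smul_mem _ _ hx

lemma isLeftCoidealSubalgebra_coidealL (i : ZMod k) :
    IsLeftCoidealSubalgebra (coidealL k i) where
  one_mem := by
    refine mem_coidealL_of_coord (fun t a b => by simp only [dCoord_one]) fun t a b => ?_
    simp only [eCoord_one, sub_left_inj]
    split_ifs with h
    · rw [h, sub_self, mul_zero, etaPow_zero, one_mul]
    · rw [mul_zero]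
  mul_mem x hx y hy := by
    have hx := coord_of_mem_coidealL hx
    have hy := coord_of_mem_coidealL hy
    refine mem_coidealL_of_coord (fun t a b => ?_) fun t a b => ?_
    · rw [dCoord_mul, dCoord_mul, hx.1, hy.1]
    -- Translating the inner index `c` as well, the two phases add up: `t(c - a) + t(b - c) = t(b -
    -- a)`.
    · rw [eCoord_mul, eCoord_mul, ← sum_shift (-(i * t)), Finset.mul_sum]
      refine Finset.sum_congr rfl fun c _ => ?_
      rw [← sub_eq_add_neg, hx.2, hy.2, mul_mul_mul_comm, etaPow_mul]
      ring_nf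
  comul_mem _ hx := comul_mem_of_mem_coidealL hx

/-- The adjoint action convolves each diagonal with a kernel depending only on `a - n`, so it
commutes with translation along the diagonal. The phase depends only on `b - a` and factors out. -/
lemma isAdNormal_coidealL (i : ZMod k) : IsAdNormal (coidealL k i) := fun x y hy => by
  have hy := coord_of_mem_coidealL hy
  refine mem_coidealL_of_coord (fun t a b => ?_) fun t a b => ?_
  · rw [dCoord_adAction, dCoord_adAction, hy.1]
  · rw [eCoord_adAction, eCoord_adAction, mul_left_comm, sub_sub_sub_cancel_right]
    congr 1
    rw [Finset.mul_sum]
    refine Finset.sum_congr rfl fun j _ => ?_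
    rw [mul_left_comm]
    congr 1
    rw [Finset.mul_sum, ← sum_shift (-(i * t))]
    refine Finset.sum_congr rfl fun n _ => ?_
    have h := hy.2 t n (n + (b - a))
    rw [add_sub_cancel_left, add_sub_right_comm] at h
    rw [← sub_eq_add_neg, h, sub_sub_sub_cancel_right, mul_left_comm]

/-- The integral is the indicator of `Γ_i`, on which every element of `L'_i` is constant with value
its coefficient at `(0, 0)`, that is, its counit. -/
lemma isNormalizedIntegral_coidealL (i : ZMod k) :
    IsNormalizedIntegral (coidealL k i) (coidealD i 0 0) := by
  have hd : ∀ x ∈ coidealL k i, ∀ a b,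
      dCoord a b x * dCoord a b (coidealD i 0 0) =
        dCoord 0 0 x * dCoord a b (coidealD i 0 0) := fun x hx a b => by
    simp only [coidealD, map_sum, dCoord_d, Finset.mul_sum]
    refine Finset.sum_congr rfl fun r _ => ?_
    split_ifs with h
    · rw [← h.1, ← h.2, (coord_of_mem_coidealL hx).1]
    · simp
  have he : ∀ a b, eCoord a b (coidealD i 0 0) = 0 := fun a b => by simp [coidealD, eCoord_d]
  refine ⟨coidealD_mem i 0 0, fun x hx => ?_, fun x hx => ?_, ?_⟩
  · rw [counit_eq_dCoord]
    refine ext_coord (fun a b => ?_) fun a b => ?_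
    · rw [dCoord_mul, mul_comm, hd x hx, map_smul, smul_eq_mul]
    · simp [eCoord_mul, he]
  · rw [counit_eq_dCoord]
    refine ext_coord (fun a b => ?_) fun a b => ?_
    · rw [dCoord_mul, hd x hx, map_smul, smul_eq_mul]
    · simp [eCoord_mul, he]
  · rw [counit_eq_dCoord]
    simp only [coidealD, map_sum, dCoord_d]
    rw [Finset.sum_eq_single 0] <;> simp +contextual

end Sekine
-- The central subspace `L'_k` and the nilpotent series
namespace Sekine

variable {k : ℕ} [NeZero k]

/-- The identity of the commutative summand. -/
def dUnit (k : ℕ) [NeZero k] : Sekine k := ∑ r, ∑ s, d k r s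

/-- The identity of the matrix summand. -/
def eUnit (k : ℕ) [NeZero k] : Sekine k := ∑ s, e k s s

lemma dCoord_dUnit (a b : ZMod k) : dCoord a b (dUnit k) = 1 := by
  simp [dUnit, dCoord_d, ite_and]

lemma eCoord_dUnit (a b : ZMod k) : eCoord a b (dUnit k) = 0 := by
  simp [dUnit, eCoord_d]

lemma dCoord_eUnit (a b : ZMod k) : dCoord a b (eUnit k) = 0 := by
  simp [eUnit, dCoord_e]

lemma eCoord_eUnit (a b : ZMod k) : eCoord a b (eUnit k) = if a = b then 1 else 0 := by
  simp [eUnit, eCoord_e, ite_and, eq_comm]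

lemma dUnit_mem : dUnit k ∈ coidealTop k := Submodule.subset_span (Or.inl rfl)

lemma eUnit_mem : eUnit k ∈ coidealTop k := Submodule.subset_span (Or.inr rfl)

lemma mem_coidealTop {x : Sekine k} :
    x ∈ coidealTop k ↔ ∃ a b : ℂ, a • dUnit k + b • eUnit k = x := Submodule.mem_span_pair

lemma coidealTop_central : ∀ x ∈ coidealTop k, ∀ y, x * y = y * x := by
  refine central_of_mem_span fun x hx y => ?_
  obtain rfl | rfl := hx
  · change dUnit k * y = y * dUnit k
    refine ext_coord (fun a b => ?_) fun a b => ?_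
    · simp [dCoord_mul, dCoord_dUnit]
    · simp [eCoord_mul, eCoord_dUnit]
  · change eUnit k * y = y * eUnit k
    refine ext_coord (fun a b => ?_) fun a b => ?_
    · simp [dCoord_mul, dCoord_eUnit]
    · simp [eCoord_mul, eCoord_eUnit]

/-- Together with `comul_eUnit` this says that `dUnit - eUnit` is group-like, of square one, so
`L'_k` is spanned by `1` and a group-like element. -/
lemma comul_dUnit :
    comulLin k (dUnit k) = dUnit k ⊗ₜ[ℂ] dUnit k + eUnit k ⊗ₜ[ℂ] eUnit k := by
  simp only [dUnit, map_sum, comulLin_d, comulD, Finset.sum_add_distrib]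
  congr 1
  · simp only [TensorProduct.sum_tmul, TensorProduct.tmul_sum]
    refine sum4_reindex _ _
      { toFun := fun t => (t.1 - t.2.2.1, t.2.1 - t.2.2.2, t.2.2.1, t.2.2.2)
        invFun := fun t => (t.1 + t.2.2.1, t.2.1 + t.2.2.2, t.2.2.1, t.2.2.2)
        left_inv := fun t => by simp
        right_inv := fun t => by simp } fun t => rfl
  · simp only [Finset.smul_sum, smul_smul]
    trans ∑ j : ZMod k, ∑ m, e k m (m - 0) ⊗ₜ[ℂ] e k (m + j) (m - 0 + j)
    -- Summing `η^{i(m-n)}` over `i` gives `k` if `m = n` and `0` otherwise, so only diagonal matrix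
    -- units survive.
    · exact sum4_collapse 0 _ (fun m n => m - n) (fun _ _ _ => rfl)
        (fun m n => by rw [sub_zero, sub_eq_zero])
        (fun j m n => e k m n ⊗ₜ[ℂ] e k (m + j) (n + j))
    · rw [Finset.sum_comm]
      simp only [eUnit, TensorProduct.sum_tmul, TensorProduct.tmul_sum, sub_zero]
      rw [Finset.sum_comm]
      refine sum2_reindex _ _
        { toFun := fun t => (t.2 + t.1, t.2)
          invFun := fun t => (t.1 - t.2, t.2)
          left_inv := fun t => by simp
          right_inv := fun t => by simp } fun t => rfl

/-- Obtained by subtracting `comul_dUnit` from `Δ(1) = 1 ⊗ 1`. -/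
lemma comul_eUnit :
    comulLin k (eUnit k) = dUnit k ⊗ₜ[ℂ] eUnit k + eUnit k ⊗ₜ[ℂ] dUnit k := by
  have h := comul_one' (k := k)
  have h1 : (1 : Sekine k) = dUnit k + eUnit k := one_eq
  rw [h1, map_add, comul_dUnit, Algebra.TensorProduct.one_def, h1, TensorProduct.add_tmul,
    TensorProduct.tmul_add, TensorProduct.tmul_add] at h
  rw [← sub_eq_zero] at h ⊢
  rw [← h]
  abel

lemma isLeftCoidealSubalgebra_coidealTop : IsLeftCoidealSubalgebra (coidealTop k) where
  one_mem := by
    rw [one_eq]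
    exact add_mem dUnit_mem eUnit_mem
  mul_mem x hx y hy := by
    obtain ⟨a, b, rfl⟩ := mem_coidealTop.1 hx
    obtain ⟨a', b', rfl⟩ := mem_coidealTop.1 hy
    refine mem_coidealTop.2 ⟨a * a', b * b', ?_⟩
    refine ext_coord (fun p q => ?_) fun p q => ?_
    · simp [dCoord_mul, dCoord_dUnit, dCoord_eUnit]
    · simp [eCoord_mul, eCoord_dUnit, eCoord_eUnit]
  comul_mem x hx := by
    obtain ⟨a, b, rfl⟩ := mem_coidealTop.1 hx
    change comulLin k _ ∈ _
    rw [map_add, map_smul, map_smul, comul_dUnit, comul_eUnit]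
    have hd : ∀ z : Sekine k, _ := fun z => tmul_mem_range_lTensor z dUnit_mem
    have he : ∀ z : Sekine k, _ := fun z => tmul_mem_range_lTensor z eUnit_mem
    exact add_mem (Submodule.smul_mem _ _ (add_mem (hd _) (he _)))
      (Submodule.smul_mem _ _ (add_mem (he _) (hd _)))

lemma isNormalizedIntegral_coidealTop : IsNormalizedIntegral (coidealTop k) (dUnit k) := by
  have h : ∀ x ∈ coidealTop k, x * dUnit k = Coalgebra.counit (R := ℂ) x • dUnit k := by
    intro x hx
    obtain ⟨a, b, rfl⟩ := mem_coidealTop.1 hx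
    rw [counit_eq_dCoord]
    refine ext_coord (fun p q => ?_) fun p q => ?_
    · simp [dCoord_mul, dCoord_dUnit, dCoord_eUnit]
    · simp [eCoord_mul, eCoord_dUnit, eCoord_eUnit]
  exact ⟨dUnit_mem, fun x hx => by rw [← h x hx, coidealTop_central x hx], h,
    by rw [counit_eq_dCoord, dCoord_dUnit]⟩

lemma coidealTop_le_coidealL (i : ZMod k) : coidealTop k ≤ coidealL k i := by
  refine Submodule.span_le.2 fun x hx => ?_
  obtain rfl | rfl := hx
  · refine mem_coidealL_of_coord (x := dUnit k) (fun t a b => ?_) fun t a b => ?_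
    · simp only [dCoord_dUnit]
    · simp only [eCoord_dUnit, mul_zero]
  · refine mem_coidealL_of_coord (x := eUnit k) (fun t a b => ?_) fun t a b => ?_
    · simp only [dCoord_eUnit]
    · simp only [eCoord_eUnit, sub_left_inj]
      split_ifs with h
      · rw [h, sub_self, mul_zero, etaPow_zero, one_mul]
      · rw [mul_zero]

/-- Without matrix part, `l` confines `A l` to the commutative summand. -/
lemma mul_mem_centerOf {l : Sekine k} (hl : ∀ a b, eCoord a b l = 0) (x : Sekine k) :
    x * l ∈ centerOf (Set.range fun a : Sekine k => a * l) := by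
  refine ⟨⟨x, rfl⟩, ?_⟩
  rintro _ ⟨y, rfl⟩
  refine ext_coord (fun a b => ?_) fun a b => ?_
  · simp only [dCoord_mul, mul_comm]
  · simp [eCoord_mul, hl]

lemma eCoord_coidealD (i p q a b : ZMod k) : eCoord a b (coidealD i p q) = 0 := by
  simp [coidealD, eCoord_d]

lemma isNilpotentSeries :
    IsNilpotentSeries ![Submodule.span ℂ {(1 : Sekine k)}, coidealTop k, coidealL k 1, ⊤] where
  zero_eq := rfl
  last_eq := rfl
  coideal j := by
    fin_cases j
    · exact isLeftCoidealSubalgebra_span_one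
    · exact isLeftCoidealSubalgebra_coidealTop
    · exact isLeftCoidealSubalgebra_coidealL 1
    · exact isLeftCoidealSubalgebra_top
  normal j := by
    fin_cases j
    · exact isAdNormal_of_central (central_of_mem_span (by simp))
    · exact isAdNormal_of_central coidealTop_central
    · exact isAdNormal_coidealL 1
    · exact fun _ _ _ => trivial
  le_succ j := by
    fin_cases j
    · exact Submodule.span_le.2
        (Set.singleton_subset_iff.2 isLeftCoidealSubalgebra_coidealTop.one_mem)
    · exact coidealTop_le_coidealL 1
    · exact le_top
  central j := by
    fin_cases j
    -- The integral of `ℂ1` is `1`, so the condition reads `L'_k ⊆ Z(A)`.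
    · refine ⟨1, isNormalizedIntegral_one, fun x hx => ⟨⟨x, rfl⟩, ?_⟩⟩
      rintro _ ⟨y, rfl⟩
      simpa using coidealTop_central x hx y
    · exact ⟨dUnit k, isNormalizedIntegral_coidealTop,
        fun x _ => mul_mem_centerOf eCoord_dUnit x⟩
    · exact ⟨coidealD 1 0 0, isNormalizedIntegral_coidealL 1,
        fun x _ => mul_mem_centerOf (eCoord_coidealD 1 0 0) x⟩

/-! ### Semisimplicity and the solvable series -/

instance : IsSemisimpleRing (Sekine k) :=
  inferInstanceAs (IsSemisimpleRing ((ZMod k × ZMod k → ℂ) × Matrix (ZMod k) (ZMod k) ℂ))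

lemma coord_of_mem_coidealL_zero {x : Sekine k} (hx : x ∈ coidealL k 0) :
    (∀ a b, dCoord a b x = dCoord 0 b x) ∧ ∀ a b, a ≠ b → eCoord a b x = 0 := by
  obtain ⟨hd, he⟩ := coord_of_mem_coidealL hx
  refine ⟨fun a b => ?_, fun a b hab => ?_⟩
  · rw [← hd a a b, sub_self, zero_mul, sub_zero]
  -- For `i = 0` covariance says that the entry equals `η^{t(b-a)}` times itself for all `t`;
  -- summing over `t` kills it off the diagonal.
  · have h : (k : ℂ) * eCoord a b x = (∑ t, etaPow k (t * (b - a))) * eCoord a b x := by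
      simp only [Finset.sum_mul, ← he, zero_mul, sub_zero, Finset.sum_const, Finset.card_univ,
        ZMod.card, nsmul_eq_mul]
    rw [sum_etaPow, if_neg (sub_ne_zero.2 hab.symm), zero_mul] at h
    exact (mul_eq_zero.1 h).resolve_left k_ne_zero

/-- On the diagonal, the coefficients of `x` at `(i, 0)` all equal `ε(x)`, so the Fourier
projections of `y` enter with equal weight and add up to `ε(x) y`. -/
lemma adAction_of_mem_coidealL_zero {x y : Sekine k} (hx : x ∈ coidealL k 0)
    (hy : y ∈ coidealL k 0) : adAction x y = Coalgebra.counit (R := ℂ) x • y := by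
  have hx := coord_of_mem_coidealL_zero hx
  have hy := coord_of_mem_coidealL_zero hy
  rw [counit_eq_dCoord]
  refine ext_coord (fun a b => ?_) fun a b => ?_
  · rw [dCoord_adAction, map_smul, smul_eq_mul]
  · rw [eCoord_adAction, map_smul, smul_eq_mul]
    by_cases hab : a = b
    · subst hab
      simp only [sub_self, add_zero, hx.1, ← Finset.mul_sum]
      rw [Finset.sum_comm]
      simp only [← Finset.sum_mul, sum_etaPow, sub_eq_zero, ite_mul, zero_mul,
        Finset.sum_ite_eq, Finset.mem_univ, if_true]
      have := k_ne_zero (k := k)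
      field_simp
    · have h : ∀ n, eCoord n (n + (b - a)) y = 0 := fun n =>
        hy.2 _ _ fun h => hab (sub_eq_zero.1 (left_eq_add.1 h)).symm
      simp [h, hy.2 a b hab]

lemma isSolvableSeries :
    IsSolvableSeries ![Submodule.span ℂ {(1 : Sekine k)}, coidealL k 0, ⊤] where
  coideal j := by
    fin_cases j
    · exact isLeftCoidealSubalgebra_span_one
    · exact isLeftCoidealSubalgebra_coidealL 0
    · exact isLeftCoidealSubalgebra_top
  le_succ j := by
    fin_cases j
    · exact Submodule.span_le.2
        (Set.singleton_subset_iff.2 (isLeftCoidealSubalgebra_coidealL 0).one_mem)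
    · exact le_top
  central j := by
    fin_cases j
    · refine ⟨1, isNormalizedIntegral_one,
        ⟨(isLeftCoidealSubalgebra_coidealL 0).one_mem, fun y _ => by simp⟩, fun x hx y hy => ?_⟩
      rw [mul_one, mul_one, adAction_of_mem_coidealL_zero hx hy]
    · refine ⟨coidealD 0 0 0, isNormalizedIntegral_coidealL 0, ⟨trivial, fun y _ => ?_⟩,
        fun x _ y _ => ?_⟩
      · refine ext_coord (fun a b => ?_) fun a b => ?_
        · simp only [dCoord_mul, mul_comm]
        · simp [eCoord_mul, eCoord_coidealD]
      · rw [counit_eq_dCoord]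
        refine ext_coord (fun a b => ?_) fun a b => ?_
        · rw [map_smul, dCoord_mul, dCoord_mul, dCoord_adAction, smul_eq_mul, mul_assoc]
        · simp [eCoord_mul, eCoord_coidealD]

/-! ### Dimension, noncommutativity and non-cocommutativity -/

lemma finrank_eq : Module.finrank ℂ (Sekine k) = k ^ 2 + k ^ 2 := by
  change Module.finrank ℂ ((ZMod k × ZMod k → ℂ) × Matrix (ZMod k) (ZMod k) ℂ) = _
  rw [Module.finrank_prod, Module.finrank_pi, Module.finrank_matrix]
  simp [ZMod.card, sq]

lemma not_commutative (hk : (0 : ZMod k) ≠ 1) : ¬ ∀ x y : Sekine k, x * y = y * x := fun h => by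
  have := congrArg (eCoord 0 0) (h (e k 0 1) (e k 1 0))
  simp [e_mul_e, eCoord_e, hk.symm] at this

/-- The coefficient of `d_{01} ⊗ e_{11}` is `1` in `Δ(e_{00})`. In the flipped coproduct `d_{01}`
occurs only with `e_{-1,-1}`, so the coefficient is `0` when `1 ≠ -1`. -/
lemma not_isCocomm (hk : (1 : ZMod k) ≠ -1) : ¬ Coalgebra.IsCocomm ℂ (Sekine k) := fun _ => by
  have h : TensorProduct.comm ℂ _ _ (comulLin k (e k 0 0)) = comulLin k (e k 0 0) :=
    Coalgebra.comm_comul ℂ (e k 0 0)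
  have := congrArg (fun z => TensorProduct.lid ℂ ℂ (TensorProduct.map (dCoord 0 1) (eCoord 1 1) z)) h
  simp [comulLin_e, comulE, dCoord_d, eCoord_d, dCoord_e, eCoord_e, etaPow_zero, ite_and,
    neg_eq_iff_eq_neg, hk.symm] at this

end Sekine

lemma ne_prime_pow_mul_prime_pow {n : ℕ} (h2 : 2 ∣ n) (h3 : 3 ∣ n) (h5 : 5 ∣ n)
    {p q : ℕ} (a b : ℕ) (hp : p.Prime) (hq : q.Prime) : n ≠ p ^ a * q ^ b := by
  rintro rfl
  have key : ∀ r : ℕ, r.Prime → r ∣ p ^ a * q ^ b → r = p ∨ r = q := fun r hr h =>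
    (hr.dvd_mul.1 h).imp (fun h => (Nat.prime_dvd_prime_iff_eq hr hp).1 (hr.dvd_of_dvd_pow h))
      fun h => (Nat.prime_dvd_prime_iff_eq hr hq).1 (hr.dvd_of_dvd_pow h)
  have := key 2 (by norm_num) h2
  have := key 3 (by norm_num) h3
  have := key 5 (by norm_num) h5
  -- Pigeonhole: `2`, `3` and `5` would all lie in `{p, q}`.
  omega

end

theorem mainTheorem1 :
    (∀ (k : ℕ) [NeZero k],
      IsNilpotentHopf (Sekine k) ∧
      IsNilpotentSeries
        ![Submodule.span ℂ {(1 : Sekine k)}, Sekine.coidealTop k, Sekine.coidealL k 1, ⊤]) ∧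
    (IsSolvableHopf (Sekine 15) ∧
      Module.finrank ℂ (Sekine 15) = 2 * 3 ^ 2 * 5 ^ 2 ∧
      (∀ p q a b : ℕ, p.Prime → q.Prime → Module.finrank ℂ (Sekine 15) ≠ p ^ a * q ^ b) ∧
      (¬ ∀ x y : Sekine 15, x * y = y * x) ∧
      ¬ Coalgebra.IsCocomm ℂ (Sekine 15)) := by
  refine ⟨fun k _ => ⟨⟨inferInstance, 3, _, Sekine.isNilpotentSeries⟩, Sekine.isNilpotentSeries⟩,
    ⟨inferInstance, 2, _, rfl, rfl, Sekine.isSolvableSeries⟩, ?_, fun p q a b hp hq => ?_,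
    Sekine.not_commutative (by decide), Sekine.not_isCocomm (by decide)⟩
  · rw [Sekine.finrank_eq]; norm_num
  · rw [Sekine.finrank_eq]
    exact ne_prime_pow_mul_prime_pow (by norm_num) (by norm_num) (by norm_num) a b hp hq
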